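/- For $N\ge 1$ let $S^{N-1}(\sqrt N)\subset\mathbb R^N$ be the sphere of radius $\sqrt N$ centred at the origin, let $\sigma^N$ be the uniform probability measure on it, and let $\gamma(v)=(2\pi)^{-1/2}e^{-v^2/2}$, identified with the standard Gaussian measure on $\mathbb R$. For probability measures $\mu,\nu$ on a measurable space, let $H(\mu|\nu)=\int h\log h\,d\nu\in[0,+\infty]$ if $\mu\ll\nu$ with $h=d\mu/d\nu$, and $H(\mu|\nu)=+\infty$ otherwise. For a probability density $f$ on $\mathbb R$ write $H(f|\gamma)=H(f\,dv|\gamma)=\int_{\mathbb R} f\log(f/\gamma)\,dv$. Let $\mu$ be a Borel probability measure on $\mathbb R$. A sequence $(\mu^{(N)})_{N\ge1}$ of probability measures, $\mu^{(N)}$ on $S^{N-1}(\sqrt N)$, is called entropically $\mu$-chaotic if (i) each $\mu^{(N)}$ is invariant under permutations of the variables $v_1,\dots,v_N$; (ii) for every integer $k\ge1$ and every bounded continuous $\chi:\mathbb R^k\to\mathbb R$, $$\int \chi(v_1,\dots,v_k)\,d\mu^{(N)}(v_1,\dots,v_N)\ \longrightarrow\ \int_{\mathbb R^k}\chi\,d\mu^{\otimes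 k}\qquad (N\to\infty);$$ (iii) $\displaystyle \lim_{N\to\infty}\frac{H(\mu^{(N)}|\sigma^N)}{N}=H(\mu|\gamma)$. **Theorem.** Let $f$ be a probability density on $\mathbb R$ with $$\int_{\mathbb R} f(v)\,v^2\,dv=1\qquad\text{and}\qquad H(f|\gamma)<+\infty .$$ Then there exists an entropically $f(v)\,dv$-chaotic sequence $(\mu^{(N)})_{N\ge1}$ of probability measures on the spheres $S^{N-1}(\sqrt N)$. -/

import Mathlib

open MeasureTheory Filter
open scoped Topology BoundedContinuousFunction ENNReal

noncomputable section

namespace KacChaos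

/-- The sphere `S^{N-1}(√N)` of radius `√N` in `ℝ^N`. -/
abbrev KacSphere (N : ℕ) : Type :=
  Metric.sphere (0 : EuclideanSpace ℝ (Fin N)) (Real.sqrt N)

/-- The dilation `x ↦ √N x` from the unit sphere of `ℝ^N` onto `S^{N-1}(√N)`. -/
def dilate (N : ℕ) (x : Metric.sphere (0 : EuclideanSpace ℝ (Fin N)) 1) : KacSphere N :=
  ⟨Real.sqrt N • (x : EuclideanSpace ℝ (Fin N)), by
    have hx : ‖(x : EuclideanSpace ℝ (Fin N))‖ = 1 := by simp
    rw [mem_sphere_zero_iff_norm, norm_smul, hx, mul_one, Real.norm_eq_abs,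
      abs_of_nonneg (Real.sqrt_nonneg _)]⟩

/-- The surface measure of the unit sphere of `ℝ^N`. -/
def unitSurface (N : ℕ) : Measure (Metric.sphere (0 : EuclideanSpace ℝ (Fin N)) 1) :=
  (volume : Measure (EuclideanSpace ℝ (Fin N))).toSphere

/-- The uniform probability measure `σ^N` on `S^{N-1}(√N)` (for `1 ≤ N`): the normalized surface
measure of the unit sphere, transported by the dilation of ratio `√N`. -/
def uniformMeasure (N : ℕ) : Measure (KacSphere N) :=
  ((unitSurface N Set.univ)⁻¹ • unitSurface N).map (dilate N)

/-- The action of a permutation of the coordinates `v_1, …, v_N` on `S^{N-1}(√N)`. -/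
def permute {N : ℕ} (π : Equiv.Perm (Fin N)) (x : KacSphere N) : KacSphere N :=
  ⟨LinearIsometryEquiv.piLpCongrLeft 2 ℝ ℝ π (x : EuclideanSpace ℝ (Fin N)), by
    have hx : ‖(x : EuclideanSpace ℝ (Fin N))‖ = Real.sqrt N := by simp
    rw [mem_sphere_zero_iff_norm, LinearIsometryEquiv.norm_map, hx]⟩

/-- The projection `(v_1, …, v_N) ↦ (v_1, …, v_k)`. It is only meaningful for `k ≤ N`; missing
coordinates are filled up by `0`. -/
def firstCoords (k N : ℕ) (x : KacSphere N) : Fin k → ℝ :=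
  fun i => if h : (i : ℕ) < N then (x : EuclideanSpace ℝ (Fin N)) ⟨i, h⟩ else 0

/-- The marginal `P_k ν` for the first `k` velocities of a measure `ν` on `S^{N-1}(√N)`. -/
def marginal (k : ℕ) {N : ℕ} (ν : Measure (KacSphere N)) : Measure (Fin k → ℝ) :=
  ν.map (firstCoords k N)

/-- Let `μ` be a probability measure on `ℝ`. The sequence `(μN N)`, `N = 1, 2, …`, of probability
measures on the spheres `S^{N-1}(√N)` is `μ`-chaotic. (The value at `N = 0` plays no role.) -/
structure IsChaotic (μ : Measure ℝ) (μN : (N : ℕ) → Measure (KacSphere N)) : Prop where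
  isProbabilityMeasure : ∀ N : ℕ, 0 < N → IsProbabilityMeasure (μN N)
  symmetric : ∀ N : ℕ, 0 < N → ∀ π : Equiv.Perm (Fin N), (μN N).map (permute π) = μN N
  tendsto_marginal : ∀ k : ℕ, 0 < k → ∀ χ : (Fin k → ℝ) →ᵇ ℝ,
    Tendsto (fun N : ℕ => ∫ v, χ v ∂(marginal k (μN N))) atTop
      (𝓝 (∫ v, χ v ∂(Measure.pi (fun _ : Fin k => μ))))

/-- The sequence `(μN N)` is entropically `μ`-chaotic: it is `μ`-chaotic and
`H(μN N | σ^N) / N → H(μ | γ)`, with `γ` the standard Gaussian measure on `ℝ`. The relative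
entropies take their values in `[0, ∞]`. -/
structure IsEntropicallyChaotic (μ : Measure ℝ) (μN : (N : ℕ) → Measure (KacSphere N)) : Prop
    extends IsChaotic μ μN where
  tendsto_entropy :
    Tendsto (fun N : ℕ => InformationTheory.klDiv (μN N) (uniformMeasure N) / (N : ℝ≥0∞)) atTop
      (𝓝 (InformationTheory.klDiv μ (ProbabilityTheory.gaussianReal 0 1)))

/-- The measure `f(v) dv` on `ℝ`. -/
def densityMeasure (f : ℝ → ℝ) : Measure ℝ :=
  (volume : Measure ℝ).withDensity (fun v => ENNReal.ofReal (f v))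

end KacChaos

end

/-! Take independent coordinates of law `μ` and project the resulting vector radially onto
`S^{N-1}(√N)`. By the law of large numbers the scaling factor `√N / ‖x‖` tends to `1`, so that
asymptotically the projection does not affect finitely many coordinates: this is chaoticity.

The projection sends the standard Gaussian measure to `σ^N`, whence `H(μ^{(N)} | σ^N) ≤ N H(μ | γ)`
by the data processing inequality and the additivity of entropy.

Conversely, test the Donsker–Varadhan inequality on the sphere with `v ↦ ∑ᵢ φ(vᵢ)`, for `φ`
continuous with compact support. Under the Gaussian measure the norm is independent of the
projection, so conditioning on `√N / ‖x‖` being close to `1` leaves `∫ exp (∑ᵢ φ(vᵢ)) dσ^N`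
unchanged, and for large `N` bounds it by `2 (e^ε ∫ e^φ dγ)^N`. Hence
`liminf H(μ^{(N)} | σ^N) / N ≥ ∫ φ dμ - log ∫ e^φ dγ`, and the supremum of the right-hand side over
`φ` is `H(μ | γ)`. -/

namespace KacChaos

open InformationTheory ProbabilityTheory TopologicalSpace

section DonskerVaradhan

variable {α : Type*} [MeasurableSpace α]

/-- The Donsker–Varadhan functional `φ ↦ ∫ φ dμ - log ∫ e^φ dν`, whose supremum over test functions
`φ` is the relative entropy `H(μ | ν)`. -/
noncomputable def dvFunctional (μ ν : Measure α) (φ : α → ℝ) : ℝ :=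
  ∫ x, φ x ∂μ - Real.log (∫ x, Real.exp (φ x) ∂ν)

theorem ofReal_dvFunctional_le_klDiv (μ ν : Measure α) [IsProbabilityMeasure μ]
    [IsProbabilityMeasure ν] {φ : α → ℝ} (hφ : Integrable φ μ)
    (hexp : Integrable (fun x => Real.exp (φ x)) ν) :
    ENNReal.ofReal (dvFunctional μ ν φ) ≤ klDiv μ ν := by
  by_cases h : klDiv μ ν = ∞
  · simp [h]
  obtain ⟨hac, hint⟩ := klDiv_ne_top_iff.1 h
  have := isProbabilityMeasure_tilted hexp
  have gibbs : 0 ≤ ∫ x, llr μ (ν.tilted φ) x ∂μ := by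
    simpa using integral_llr_add_sub_measure_univ_nonneg
      (hac.trans (absolutelyContinuous_tilted hexp)) (integrable_llr_tilted_right hac hφ hint hexp)
  rw [integral_llr_tilted_right hac hφ hexp hint] at gibbs
  rw [klDiv_of_ac_of_integrable hac hint]
  apply ENNReal.ofReal_le_ofReal
  simp only [probReal_univ, dvFunctional]
  linarith

theorem integrable_exp_of_abs_le {ν : Measure α} [IsFiniteMeasure ν] {φ : α → ℝ}
    (hφ : AEMeasurable φ ν) {M : ℝ} (hM : ∀ x, |φ x| ≤ M) :
    Integrable (fun x => Real.exp (φ x)) ν := by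
  simpa using integrable_exp_mul_of_mem_Icc (t := 1) hφ (ae_of_all ν fun x => abs_le.1 (hM x))

theorem tendsto_dvFunctional {μ ν : Measure α} [IsFiniteMeasure μ] [IsFiniteMeasure ν] [NeZero ν]
    {φ : α → ℝ} {φs : ℕ → α → ℝ} {M : ℝ} (hφs : ∀ n, Measurable (φs n))
    (hM : ∀ n x, |φs n x| ≤ M) (hφ : Measurable φ) (hφM : ∀ x, |φ x| ≤ M)
    (hμ : ∀ᵐ x ∂μ, Tendsto (φs · x) atTop (𝓝 (φ x)))
    (hν : ∀ᵐ x ∂ν, Tendsto (φs · x) atTop (𝓝 (φ x))) :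
    Tendsto (fun n => dvFunctional μ ν (φs n)) atTop (𝓝 (dvFunctional μ ν φ)) := by
  have hlin : Tendsto (fun n => ∫ x, φs n x ∂μ) atTop (𝓝 (∫ x, φ x ∂μ)) :=
    tendsto_integral_of_dominated_convergence (fun _ => M)
      (fun n => (hφs n).aestronglyMeasurable) (integrable_const M) (fun n => ae_of_all μ (hM n)) hμ
  have hexp : Tendsto (fun n => ∫ x, Real.exp (φs n x) ∂ν) atTop (𝓝 (∫ x, Real.exp (φ x) ∂ν)) := by
    refine tendsto_integral_of_dominated_convergence (fun _ => Real.exp M)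
      (fun n => (hφs n).exp.aestronglyMeasurable) (integrable_const _)
      (fun n => ae_of_all ν fun x => ?_) ?_
    · simpa using (le_abs_self _).trans (hM n x)
    · filter_upwards [hν] with x hx using hx.rexp
  exact hlin.sub <| hexp.log (integral_exp_pos (integrable_exp_of_abs_le hφ.aemeasurable hφM)).ne'

theorem exists_lt_dvFunctional_of_not_ac {μ ν : Measure α} [IsFiniteMeasure μ]
    [IsProbabilityMeasure ν] (h : ¬ μ ≪ ν) (c : ℝ) :
    ∃ (φ : α → ℝ) (M : ℝ), Measurable φ ∧ (∀ x, |φ x| ≤ M) ∧ c < dvFunctional μ ν φ := by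
  obtain ⟨s, hs, hνs, hμs⟩ : ∃ s, MeasurableSet s ∧ ν s = 0 ∧ μ s ≠ 0 := by
    by_contra! hac
    exact h (.mk fun s hs hνs => hac s hs hνs)
  have hμs : 0 < μ.real s := ENNReal.toReal_pos hμs (measure_ne_top μ s)
  obtain ⟨n, hn⟩ := exists_nat_gt (c / μ.real s)
  have hexp : ∫ x, Real.exp (s.indicator (fun _ => (n : ℝ)) x) ∂ν = 1 := by
    have : ∀ᵐ x ∂ν, Real.exp (s.indicator (fun _ => (n : ℝ)) x) = 1 := by
      filter_upwards [measure_eq_zero_iff_ae_notMem.1 hνs] with x hx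
      simp [hx]
    simp [integral_congr_ae this]
  refine ⟨s.indicator fun _ => n, n, measurable_const.indicator hs, fun x => ?_, ?_⟩
  · by_cases hx : x ∈ s <;> simp [hx]
  · simpa [dvFunctional, hexp, integral_indicator hs, mul_comm] using (div_lt_iff₀ hμs).1 hn

/-- The truncation of `r` to the interval `[e⁻ⁿ, eⁿ]`, used to make the logarithm of a density
bounded. -/
noncomputable def expTruncation (n : ℕ) (r : ℝ) : ℝ :=
  max (Real.exp (-n)) (min (Real.exp n) r)

theorem expTruncation_pos (n : ℕ) (r : ℝ) : 0 < expTruncation n r :=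
  lt_max_of_lt_left (Real.exp_pos _)

@[fun_prop]
theorem measurable_expTruncation (n : ℕ) : Measurable (expTruncation n) := by
  unfold expTruncation
  fun_prop

theorem abs_log_expTruncation_le (n : ℕ) (r : ℝ) : |Real.log (expTruncation n r)| ≤ n := by
  refine abs_le.2 ⟨(Real.le_log_iff_exp_le (expTruncation_pos n r)).2 (le_max_left _ _),
    (Real.log_le_iff_le_exp (expTruncation_pos n r)).2 (max_le ?_ (min_le_left _ _))⟩
  exact Real.exp_le_exp.2 (neg_le_self n.cast_nonneg)

theorem tendsto_expTruncation {r : ℝ} (hr : 0 ≤ r) :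
    Tendsto (expTruncation · r) atTop (𝓝 r) := by
  have hlower : Tendsto (fun n : ℕ => Real.exp (-n)) atTop (𝓝 0) :=
    Real.tendsto_exp_neg_atTop_nhds_zero.comp tendsto_natCast_atTop_atTop
  have hupper : ∀ᶠ n : ℕ in atTop, r ≤ Real.exp n :=
    (Real.tendsto_exp_atTop.comp tendsto_natCast_atTop_atTop).eventually_ge_atTop r
  have hmin : Tendsto (fun n : ℕ => min (Real.exp n) r) atTop (𝓝 r) :=
    tendsto_const_nhds.congr' (hupper.mono fun n hn => (min_eq_right hn).symm)
  simpa only [max_eq_right hr, expTruncation] using hlower.max hmin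

/-- The integrand `klFun r = r log r + 1 - r` of the relative entropy, with `r` truncated everywhere
except in the factor in front of the logarithm, so that it stays linear in the density. -/
noncomputable def truncatedKlFun (n : ℕ) (r : ℝ) : ℝ :=
  r * Real.log (expTruncation n r) + 1 - expTruncation n r

@[fun_prop]
theorem measurable_truncatedKlFun (n : ℕ) : Measurable (truncatedKlFun n) := by
  unfold truncatedKlFun
  fun_prop

theorem truncatedKlFun_nonneg (n : ℕ) (r : ℝ) : 0 ≤ truncatedKlFun n r := by
  rw [truncatedKlFun]
  set k := expTruncation n r
  have hk0 : 0 < k := expTruncation_pos n r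
  have hexp : Real.exp (-n) ≤ 1 ∧ 1 ≤ Real.exp n := by simp
  -- `k` lies between `1` and `r`
  have hsign : 0 ≤ (r - k) * Real.log k := by
    rcases le_total r 1 with hr | hr
    · have hrk : r ≤ k := le_max_of_le_right (le_min (hr.trans hexp.2) le_rfl)
      have hk1 : k ≤ 1 := max_le hexp.1 ((min_le_right _ _).trans hr)
      exact mul_nonneg_of_nonpos_of_nonpos (sub_nonpos.2 hrk) (Real.log_nonpos hk0.le hk1)
    · have hkr : k ≤ r := max_le (hexp.1.trans hr) (min_le_right _ _)
      have hk1 : 1 ≤ k := le_max_of_le_right (le_min hexp.2 hr)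
      exact mul_nonneg (sub_nonneg.2 hkr) (Real.log_nonneg hk1)
  have hklFun : 0 ≤ k * Real.log k + 1 - k := klFun_nonneg hk0.le
  linarith

theorem tendsto_truncatedKlFun {r : ℝ} (hr : 0 ≤ r) :
    Tendsto (truncatedKlFun · r) atTop (𝓝 (klFun r)) := by
  have hk := tendsto_expTruncation hr
  refine Tendsto.sub (Tendsto.add_const 1 ?_) hk
  rcases hr.eq_or_lt with rfl | hr
  · simp
  · exact (hk.log hr.ne').const_mul r

theorem integral_add_one_sub_integral_exp_le_dvFunctional (μ : Measure α) {ν : Measure α}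
    [NeZero ν] {φ : α → ℝ} (hexp : Integrable (fun x => Real.exp (φ x)) ν) :
    ∫ x, φ x ∂μ + 1 - ∫ x, Real.exp (φ x) ∂ν ≤ dvFunctional μ ν φ := by
  have := Real.log_le_sub_one_of_pos (integral_exp_pos hexp)
  rw [dvFunctional]
  linarith

theorem lintegral_truncatedKlFun_le {μ ν : Measure α} [IsFiniteMeasure μ] [IsProbabilityMeasure ν]
    (h : μ ≪ ν) (n : ℕ) :
    ∫⁻ x, ENNReal.ofReal (truncatedKlFun n (μ.rnDeriv ν x).toReal) ∂ν
      ≤ ENNReal.ofReal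
          (dvFunctional μ ν fun x => Real.log (expTruncation n (μ.rnDeriv ν x).toReal)) := by
  set ρ : α → ℝ := fun x => (μ.rnDeriv ν x).toReal
  set φ : α → ℝ := fun x => Real.log (expTruncation n (ρ x))
  have hρ : Measurable ρ := (Measure.measurable_rnDeriv μ ν).ennreal_toReal
  have hφ : Measurable φ := by fun_prop
  have hφn : ∀ x, |φ x| ≤ n := fun x => abs_log_expTruncation_le n (ρ x)
  have hexp : ∀ x, truncatedKlFun n (ρ x) = ρ x * φ x + 1 - Real.exp (φ x) := fun x => by
    rw [truncatedKlFun, Real.exp_log (expTruncation_pos n (ρ x))]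
  have hφexp : Integrable (fun x => Real.exp (φ x)) ν :=
    integrable_exp_of_abs_le hφ.aemeasurable hφn
  have hρφ : Integrable (fun x => ρ x * φ x) ν :=
    (integrable_rnDeriv_smul_iff h).2
      (Integrable.of_bound hφ.aestronglyMeasurable n (ae_of_all μ hφn))
  have hρφ_one : Integrable (fun x => ρ x * φ x + 1) ν := hρφ.add (integrable_const 1)
  have hsplit : ∫ x, truncatedKlFun n (ρ x) ∂ν = ∫ x, φ x ∂μ + 1 - ∫ x, Real.exp (φ x) ∂ν := by
    simp_rw [hexp]
    rw [integral_sub hρφ_one hφexp, integral_add hρφ (integrable_const 1)]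
    simp [← integral_rnDeriv_smul h, ρ]
  have hint : Integrable (fun x => truncatedKlFun n (ρ x)) ν :=
    (hρφ_one.sub hφexp).congr (ae_of_all ν fun x => (hexp x).symm)
  rw [← ofReal_integral_eq_lintegral_ofReal hint
    (ae_of_all ν fun x => truncatedKlFun_nonneg n (ρ x)), hsplit]
  exact ENNReal.ofReal_le_ofReal (integral_add_one_sub_integral_exp_le_dvFunctional μ hφexp)

theorem exists_lt_dvFunctional_of_ac {μ ν : Measure α} [IsFiniteMeasure μ]
    [IsProbabilityMeasure ν] (h : μ ≪ ν) {c : ℝ≥0∞} (hc : c < klDiv μ ν) :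
    ∃ (φ : α → ℝ) (M : ℝ), Measurable φ ∧ (∀ x, |φ x| ≤ M) ∧
      c < ENNReal.ofReal (dvFunctional μ ν φ) := by
  set u : ℕ → α → ℝ≥0∞ := fun n x => ENNReal.ofReal (truncatedKlFun n (μ.rnDeriv ν x).toReal)
  have hlim : ∀ x, Tendsto (u · x) atTop (𝓝 (ENNReal.ofReal (klFun (μ.rnDeriv ν x).toReal))) :=
    fun x => ENNReal.tendsto_ofReal (tendsto_truncatedKlFun ENNReal.toReal_nonneg)
  have hfatou : klDiv μ ν ≤ liminf (fun n => ∫⁻ x, u n x ∂ν) atTop := by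
    rw [klDiv_eq_lintegral_klFun_of_ac h]
    simpa only [(hlim _).liminf_eq] using
      lintegral_liminf_le (μ := ν) (u := atTop) (f := u) fun n => by fun_prop
  obtain ⟨n, hn⟩ := (eventually_lt_of_lt_liminf (hc.trans_le hfatou)).exists
  exact ⟨fun x => Real.log (expTruncation n (μ.rnDeriv ν x).toReal), n, by fun_prop,
    fun x => abs_log_expTruncation_le n _, hn.trans_le (lintegral_truncatedKlFun_le h n)⟩

theorem exists_bounded_lt_dvFunctional {μ ν : Measure α} [IsFiniteMeasure μ]
    [IsProbabilityMeasure ν] {c : ℝ≥0∞} (hc : c < klDiv μ ν) :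
    ∃ (φ : α → ℝ) (M : ℝ), Measurable φ ∧ (∀ x, |φ x| ≤ M) ∧
      c < ENNReal.ofReal (dvFunctional μ ν φ) := by
  by_cases h : μ ≪ ν
  · exact exists_lt_dvFunctional_of_ac h hc
  · obtain ⟨φ, M, hφ, hM, hlt⟩ := exists_lt_dvFunctional_of_not_ac h c.toReal
    exact ⟨φ, M, hφ, hM, (ENNReal.lt_ofReal_iff_toReal_lt hc.ne_top).2 hlt⟩

end DonskerVaradhan

section CompactSupport

variable {X : Type*} [TopologicalSpace X] [PseudoMetrizableSpace X] [SigmaCompactSpace X]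
  [WeaklyLocallyCompactSpace X] [MeasurableSpace X] [BorelSpace X]

theorem exists_seq_hasCompactSupport_tendsto_ae (κ : Measure X) [IsFiniteMeasure κ]
    {φ : X → ℝ} (hφ : Measurable φ) {M : ℝ} (hM₀ : 0 ≤ M) (hM : ∀ x, |φ x| ≤ M) :
    ∃ g : ℕ → X → ℝ, (∀ n, Continuous (g n)) ∧ (∀ n, HasCompactSupport (g n)) ∧
      (∀ n x, |g n x| ≤ M) ∧ ∀ᵐ x ∂κ, Tendsto (g · x) atTop (𝓝 (φ x)) := by
  have hφint : Integrable φ κ := Integrable.of_bound hφ.aestronglyMeasurable M (ae_of_all κ hM)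
  have happrox : ∀ n : ℕ, ∃ g : X → ℝ, HasCompactSupport g ∧
      ∫⁻ x, ‖φ x - g x‖ₑ ∂κ ≤ (n : ℝ≥0∞)⁻¹ ∧ Continuous g ∧ Integrable g κ := fun n =>
    hφint.exists_hasCompactSupport_lintegral_sub_le (by simp)
  choose g hg_supp hg_le hg_cont _ using happrox
  have hL1 : Tendsto (fun n => eLpNorm (g n - φ) 1 κ) atTop (𝓝 0) := by
    refine tendsto_of_tendsto_of_tendsto_of_le_of_le tendsto_const_nhds
      ENNReal.tendsto_inv_nat_nhds_zero (fun n => zero_le) fun n => ?_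
    rw [eLpNorm_sub_comm, eLpNorm_one_eq_lintegral_enorm]
    exact hg_le n
  obtain ⟨ns, -, hns⟩ := (tendstoInMeasure_of_tendsto_eLpNorm one_ne_zero
    (fun n => (hg_cont n).aestronglyMeasurable) hφ.aestronglyMeasurable hL1).exists_seq_tendsto_ae
  set clamp : ℝ → ℝ := fun y => max (-M) (min M y)
  have hclamp_cont : Continuous clamp := by fun_prop
  have hclamp_zero : clamp 0 = 0 := by simp [clamp, hM₀]
  have hclamp_le : ∀ y, |clamp y| ≤ M := fun y =>
    abs_le.2 ⟨le_max_left _ _, max_le (by linarith) (min_le_left _ _)⟩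
  have hclamp_φ : ∀ x, clamp (φ x) = φ x := fun x => by
    simp only [clamp, min_eq_right (abs_le.1 (hM x)).2, max_eq_right (abs_le.1 (hM x)).1]
  refine ⟨fun n x => clamp (g (ns n) x), fun n => hclamp_cont.comp (hg_cont _),
    fun n => (hg_supp _).comp_left hclamp_zero, fun n x => hclamp_le _, ?_⟩
  filter_upwards [hns] with x hx
  simpa only [hclamp_φ, Function.comp_def] using (hclamp_cont.tendsto (φ x)).comp hx

theorem exists_hasCompactSupport_lt_dvFunctional {μ ν : Measure X} [IsFiniteMeasure μ]
    [IsProbabilityMeasure ν] {c : ℝ≥0∞} (hc : c < klDiv μ ν) :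
    ∃ φ : X → ℝ, Continuous φ ∧ HasCompactSupport φ ∧
      c < ENNReal.ofReal (dvFunctional μ ν φ) := by
  obtain ⟨φ, M, hφ, hM, hlt⟩ := exists_bounded_lt_dvFunctional hc
  obtain ⟨x₀⟩ := nonempty_of_isProbabilityMeasure ν
  obtain ⟨g, hg_cont, hg_supp, hgM, hlim⟩ :=
    exists_seq_hasCompactSupport_tendsto_ae (μ + ν) hφ ((abs_nonneg _).trans (hM x₀)) hM
  rw [ae_add_measure_iff] at hlim
  have hdv := ENNReal.tendsto_ofReal <|
    tendsto_dvFunctional (fun n => (hg_cont n).measurable) hgM hφ hM hlim.1 hlim.2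
  obtain ⟨n, hn⟩ := (hdv.eventually_const_lt hlt).exists
  exact ⟨g n, hg_cont n, hg_supp n, hn⟩

end CompactSupport

section Tensorization

theorem klDiv_map_measurableEquiv {α β : Type*} [MeasurableSpace α] [MeasurableSpace β]
    (μ ν : Measure α) [IsFiniteMeasure μ] [IsFiniteMeasure ν] (e : α ≃ᵐ β) :
    klDiv (μ.map e) (ν.map e) = klDiv μ ν := by
  refine le_antisymm (klDiv_map_le μ ν e.measurable) ?_
  simpa using klDiv_map_le (μ.map e) (ν.map e) e.symm.measurable

theorem klDiv_prod {α β : Type*} [MeasurableSpace α] [MeasurableSpace β] (μ ν : Measure α)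
    (μ' ν' : Measure β) [IsProbabilityMeasure μ] [IsProbabilityMeasure ν] [IsProbabilityMeasure μ']
    [IsProbabilityMeasure ν'] :
    klDiv (μ.prod μ') (ν.prod ν') = klDiv μ ν + klDiv μ' ν' := by
  have hconst : klDiv (μ.prod μ') (μ.prod ν') = klDiv μ' ν' := by
    rw [← Measure.prod_swap (μ := μ'), ← Measure.prod_swap (μ := ν')]
    refine (klDiv_map_measurableEquiv _ _ MeasurableEquiv.prodComm).trans ?_
    rw [← Measure.compProd_const, ← Measure.compProd_const, klDiv_compProd_left]
  rw [← hconst, ← Measure.compProd_const, ← Measure.compProd_const, klDiv_compProd_eq_add,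
    Measure.compProd_const, Measure.compProd_const]

theorem klDiv_pi {n : ℕ} {α : Fin n → Type*} [∀ i, MeasurableSpace (α i)]
    (μ ν : (i : Fin n) → Measure (α i)) [∀ i, IsProbabilityMeasure (μ i)]
    [∀ i, IsProbabilityMeasure (ν i)] :
    klDiv (Measure.pi μ) (Measure.pi ν) = ∑ i, klDiv (μ i) (ν i) := by
  induction n with
  | zero => rw [Measure.pi_of_empty, Measure.pi_of_empty, klDiv_self, Finset.univ_eq_empty,
      Finset.sum_empty]
  | succ n ih =>
    rw [← klDiv_map_measurableEquiv _ _ (MeasurableEquiv.piFinSuccAbove α 0),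
      (measurePreserving_piFinSuccAbove μ 0).map_eq, (measurePreserving_piFinSuccAbove ν 0).map_eq,
      klDiv_prod, ih, Fin.sum_univ_succ]
    rfl

end Tensorization

open scoped Pointwise in
theorem eventually_forall_abs_comp_smul_sub_lt {E : Type*} [NormedAddCommGroup E] [NormedSpace ℝ E]
    {φ : E → ℝ} (hφ : Continuous φ) (hφ_supp : HasCompactSupport φ) {ε : ℝ} (hε : 0 < ε) :
    ∀ᶠ t in 𝓝 (1 : ℝ), ∀ v, |φ (t • v) - φ v| < ε := by
  -- for `t ∈ [1/2, 2]` both terms vanish outside this compact set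
  set K : Set E := Set.Icc (1 / 2 : ℝ) 2 • tsupport φ
  have hK_compact : IsCompact K := isCompact_Icc.smul_set hφ_supp
  have hon : ∀ᶠ t in 𝓝 (1 : ℝ), ∀ v ∈ K, |φ (t • v) - φ v| < ε := by
    refine hK_compact.eventually_forall_of_forall_eventually fun v _ => ?_
    have hcont : Continuous fun p : ℝ × E => |φ (p.1 • p.2) - φ p.2| := by fun_prop
    exact hcont.continuousAt.eventually_lt_const (by simpa using hε)
  have hIcc : ∀ᶠ t in 𝓝 (1 : ℝ), t ∈ Set.Icc (1 / 2 : ℝ) 2 :=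
    Icc_mem_nhds (by norm_num) (by norm_num)
  filter_upwards [hon, hIcc] with t ht ht_mem v
  by_cases hv : v ∈ K
  · exact ht v hv
  · have hφv : φ v = 0 := image_eq_zero_of_notMem_tsupport fun h =>
      hv ⟨1, by norm_num, v, h, one_smul ℝ v⟩
    have ht0 : 0 < t := by linarith [ht_mem.1]
    have hφtv : φ (t • v) = 0 := image_eq_zero_of_notMem_tsupport fun h =>
      hv ⟨t⁻¹, ⟨by rw [one_div]; gcongr; exact ht_mem.2,
        (inv_le_comm₀ ht0 two_pos).2 (by linarith [ht_mem.1])⟩, t • v, h, inv_smul_smul₀ ht0.ne' v⟩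
    simpa [hφv, hφtv] using hε

section PolarCoordinates

variable {E : Type*} [NormedAddCommGroup E] [NormedSpace ℝ E] [FiniteDimensional ℝ E]
  [MeasurableSpace E] [BorelSpace E] [Nontrivial E]

theorem lintegral_normalized_mul_norm (μ : Measure E) [μ.IsAddHaarMeasure] {F : E → ℝ≥0∞}
    {G : ℝ → ℝ≥0∞} (hF : Measurable F) (hG : Measurable G) :
    ∫⁻ x, F (‖x‖⁻¹ • x) * G ‖x‖ ∂μ = (∫⁻ θ, F (θ : E) ∂μ.toSphere) *
      ∫⁻ r, G (r : ℝ) ∂(Measure.volumeIoiPow (Module.finrank ℝ E - 1)) := by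
  calc ∫⁻ x, F (‖x‖⁻¹ • x) * G ‖x‖ ∂μ
      = ∫⁻ x : ({0}ᶜ : Set E), F (‖x.1‖⁻¹ • x.1) * G ‖x.1‖ ∂(μ.comap Subtype.val) := by
        rw [lintegral_subtype_comap (measurableSet_singleton _).compl
          fun x : E => F (‖x‖⁻¹ • x) * G ‖x‖, restrict_compl_singleton]
    _ = ∫⁻ p, F (p.1 : E) * G (p.2 : ℝ)
          ∂(μ.toSphere.prod (Measure.volumeIoiPow (Module.finrank ℝ E - 1))) := by
        rw [← μ.measurePreserving_homeomorphUnitSphereProd.lintegral_comp_emb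
          (Homeomorph.measurableEmbedding _)]
        simp
    _ = _ := lintegral_prod_mul (f := fun θ : Metric.sphere (0 : E) 1 => F θ)
        (g := fun r : Set.Ioi (0 : ℝ) => G r) (hF.comp measurable_subtype_coe).aemeasurable
        (hG.comp measurable_subtype_coe).aemeasurable

theorem lintegral_normalized_mul_norm_withDensity (μ : Measure E) [μ.IsAddHaarMeasure]
    {F : E → ℝ≥0∞} {G ρ : ℝ → ℝ≥0∞} (hF : Measurable F) (hG : Measurable G) (hρ : Measurable ρ) :
    μ.toSphere Set.univ * ∫⁻ x, F (‖x‖⁻¹ • x) * G ‖x‖ ∂(μ.withDensity fun x => ρ ‖x‖) =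
      (∫⁻ θ, F (θ : E) ∂μ.toSphere) * ∫⁻ x, G ‖x‖ ∂(μ.withDensity fun x => ρ ‖x‖) := by
  have hpolar : ∀ {F : E → ℝ≥0∞}, Measurable F →
      ∫⁻ x, F (‖x‖⁻¹ • x) * G ‖x‖ ∂(μ.withDensity fun x => ρ ‖x‖) = (∫⁻ θ, F (θ : E) ∂μ.toSphere) *
        ∫⁻ r, ρ (r : ℝ) * G r ∂(Measure.volumeIoiPow (Module.finrank ℝ E - 1)) := fun {F} hF => by
    rw [lintegral_withDensity_eq_lintegral_mul _ (by fun_prop) (by fun_prop),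
      ← lintegral_normalized_mul_norm μ hF (G := fun r => ρ r * G r) (hρ.mul hG)]
    simp only [Pi.mul_apply, mul_left_comm]
  have hpolar_one := hpolar (F := fun _ => 1) measurable_const
  simp only [one_mul, lintegral_const] at hpolar_one
  rw [hpolar hF, hpolar_one, mul_left_comm]

end PolarCoordinates

open scoped Real in
theorem stdGaussian_eq_withDensity (E : Type*) [NormedAddCommGroup E] [InnerProductSpace ℝ E]
    [FiniteDimensional ℝ E] [MeasurableSpace E] [BorelSpace E] :
    stdGaussian E = volume.withDensity fun x : E => ENNReal.ofReal
      ((2 * π) ^ (-(Module.finrank ℝ E : ℝ) / 2) * Real.exp (-‖x‖ ^ 2 / 2)) := by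
  set d := Module.finrank ℝ E
  set c : ℝ := (2 * π) ^ (-(d : ℝ) / 2) with hc
  have hint : Integrable fun x : E => c * Real.exp (-‖x‖ ^ 2 / 2) := by
    have hgauss := GaussianFourier.integral_rexp_neg_mul_sq_norm (V := E) (one_half_pos (α := ℝ))
    simpa only [neg_mul, one_div_mul_eq_div, neg_div] using
      (Integrable.of_integral_ne_zero (hgauss.trans_ne (by positivity))).const_mul c
  have := isFiniteMeasure_withDensity_ofReal hint.hasFiniteIntegral
  refine Measure.ext_of_charFun (funext fun t => ?_)
  rw [charFun_stdGaussian, charFun_apply, integral_withDensity_eq_integral_toReal_smul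
    (by fun_prop) (ae_of_all _ fun x => ENNReal.ofReal_lt_top)]
  have hexp : ∀ x : E, (ENNReal.ofReal (c * Real.exp (-‖x‖ ^ 2 / 2))).toReal •
      Complex.exp (inner ℝ x t * Complex.I)
        = c * Complex.exp (-(1 / 2) * ‖x‖ ^ 2 + Complex.I * inner ℝ t x) := fun x => by
    rw [ENNReal.toReal_ofReal (by positivity), Complex.real_smul, Complex.exp_add, real_inner_comm]
    push_cast
    ring_nf
  have hc_mul : (c : ℂ) * (π / (1 / 2)) ^ ((d : ℂ) / 2) = 1 := by
    rw [hc, show (π : ℂ) / (1 / 2) = ((2 * π : ℝ) : ℂ) by push_cast; ring,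
      show (d : ℂ) / 2 = ((d / 2 : ℝ) : ℂ) by push_cast; rfl, ← Complex.ofReal_cpow (by positivity),
      ← Complex.ofReal_mul, ← Real.rpow_add (by positivity)]
    simp [neg_div]
  simp_rw [hexp]
  rw [integral_const_mul,
    GaussianFourier.integral_cexp_neg_mul_sq_norm_add (by norm_num) Complex.I t, ← mul_assoc,
    hc_mul, one_mul, Complex.I_sq]
  ring_nf

section RadialProjection

/-- The radial projection `x ↦ √N x / |x|` of `ℝ^N` onto `S^{N-1}(√N)`. The origin is sent to
`(1, …, 1)`, a choice which is invariant under permutations of the coordinates. -/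
noncomputable def radialProj (N : ℕ) (x : EuclideanSpace ℝ (Fin N)) : KacSphere N :=
  if hx : x = 0 then
    ⟨WithLp.toLp 2 fun _ => 1, by simp [EuclideanSpace.norm_eq]⟩
  else
    ⟨(√N / ‖x‖) • x, by
      rw [mem_sphere_zero_iff_norm, norm_smul, norm_div, norm_norm, Real.norm_of_nonneg (by simp),
        div_mul_cancel₀ _ (norm_ne_zero_iff.2 hx)]⟩

variable {N : ℕ}

theorem coe_radialProj_of_ne_zero {x : EuclideanSpace ℝ (Fin N)} (hx : x ≠ 0) :
    (radialProj N x : EuclideanSpace ℝ (Fin N)) = (√N / ‖x‖) • x := by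
  rw [radialProj, dif_neg hx]

@[fun_prop]
theorem measurable_radialProj (N : ℕ) : Measurable (radialProj N) := by
  have hcoe : (fun x => (radialProj N x : EuclideanSpace ℝ (Fin N))) =
      fun x => if x = 0 then WithLp.toLp 2 fun _ => 1 else (√N / ‖x‖) • x := by
    ext1 x
    unfold radialProj
    split_ifs <;> rfl
  rw [← (MeasurableEmbedding.subtype_coe Metric.isClosed_sphere.measurableSet).measurable_comp_iff,
    Function.comp_def, hcoe]
  exact Measurable.ite (measurableSet_singleton 0) measurable_const (by fun_prop)

theorem radialProj_inv_norm_smul (x : EuclideanSpace ℝ (Fin N)) :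
    radialProj N (‖x‖⁻¹ • x) = radialProj N x := by
  rcases eq_or_ne x 0 with rfl | hx
  · rw [smul_zero]
  · have hx' : ‖x‖ ≠ 0 := norm_ne_zero_iff.2 hx
    apply Subtype.ext
    rw [coe_radialProj_of_ne_zero hx, coe_radialProj_of_ne_zero (smul_ne_zero (inv_ne_zero hx') hx)]
    simp [norm_smul, smul_smul, hx', div_eq_mul_inv]

theorem radialProj_coe_sphere (θ : Metric.sphere (0 : EuclideanSpace ℝ (Fin N)) 1) :
    radialProj N θ = dilate N θ := by
  have hθ : ‖(θ : EuclideanSpace ℝ (Fin N))‖ = 1 := by simp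
  apply Subtype.ext
  rw [coe_radialProj_of_ne_zero (norm_ne_zero_iff.1 (by simp)), hθ, div_one, dilate]

theorem permute_radialProj (π : Equiv.Perm (Fin N)) (x : EuclideanSpace ℝ (Fin N)) :
    permute π (radialProj N x)
      = radialProj N (LinearIsometryEquiv.piLpCongrLeft 2 ℝ ℝ π x) := by
  apply Subtype.ext
  rcases eq_or_ne x 0 with rfl | hx
  · ext i
    simp [permute, radialProj]
  · change LinearIsometryEquiv.piLpCongrLeft 2 ℝ ℝ π (radialProj N x) = _
    rw [coe_radialProj_of_ne_zero hx, coe_radialProj_of_ne_zero (by simpa using hx),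
      LinearIsometryEquiv.norm_map, map_smul]

theorem measurable_permute (π : Equiv.Perm (Fin N)) : Measurable (permute π) :=
  ((LinearIsometryEquiv.continuous _).measurable.comp measurable_subtype_coe).subtype_mk

@[fun_prop]
theorem measurable_firstCoords (k N : ℕ) : Measurable (firstCoords k N) := by
  refine measurable_pi_lambda _ fun i => ?_
  unfold firstCoords
  split_ifs <;> fun_prop

theorem measurable_dilate (N : ℕ) : Measurable (dilate N) := by
  unfold dilate
  fun_prop

theorem lintegral_radialProj_mul_norm_stdGaussian [NeZero N] {F : KacSphere N → ℝ≥0∞}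
    {G : ℝ → ℝ≥0∞} (hF : Measurable F) (hG : Measurable G) :
    ∫⁻ x, F (radialProj N x) * G ‖x‖ ∂(stdGaussian (EuclideanSpace ℝ (Fin N)))
      = (∫⁻ v, F v ∂(uniformMeasure N)) *
        ∫⁻ x, G ‖x‖ ∂(stdGaussian (EuclideanSpace ℝ (Fin N))) := by
  have hpolar := lintegral_normalized_mul_norm_withDensity
    (volume : Measure (EuclideanSpace ℝ (Fin N))) (hF.comp (measurable_radialProj N)) hG
    (ρ := fun r => ENNReal.ofReal ((2 * Real.pi) ^ (-(N : ℝ) / 2) * Real.exp (-r ^ 2 / 2)))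
    (by fun_prop)
  have hne : unitSurface N Set.univ ≠ 0 := by
    rw [unitSurface, Ne, Measure.measure_univ_eq_zero]
    exact Measure.toSphere_ne_zero _
  have hfin : unitSurface N Set.univ ≠ ∞ := by
    unfold unitSurface
    exact measure_ne_top _ _
  have hdensity := stdGaussian_eq_withDensity (EuclideanSpace ℝ (Fin N))
  rw [finrank_euclideanSpace_fin] at hdensity
  simp only [Function.comp_apply, radialProj_inv_norm_smul, radialProj_coe_sphere, ← hdensity]
    at hpolar
  change unitSurface N Set.univ * _ = (∫⁻ θ, F (dilate N θ) ∂unitSurface N) * _ at hpolar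
  rw [uniformMeasure, lintegral_map hF (measurable_dilate N), lintegral_smul_measure, smul_eq_mul,
    mul_assoc, ← hpolar, ENNReal.inv_mul_cancel_left hne hfin]

theorem map_radialProj_stdGaussian (N : ℕ) [NeZero N] :
    (stdGaussian (EuclideanSpace ℝ (Fin N))).map (radialProj N) = uniformMeasure N := by
  refine Measure.ext_of_lintegral _ fun F hF => ?_
  rw [lintegral_map hF (measurable_radialProj N)]
  simpa using lintegral_radialProj_mul_norm_stdGaussian hF (measurable_const (a := 1))

theorem indepFun_norm_radialProj_stdGaussian (N : ℕ) [NeZero N] :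
    IndepFun (fun x => ‖x‖) (radialProj N) (stdGaussian (EuclideanSpace ℝ (Fin N))) := by
  set γ := stdGaussian (EuclideanSpace ℝ (Fin N))
  refine indepFun_iff_measure_inter_preimage_eq_mul.2 fun s t hs ht => ?_
  have hs' : MeasurableSet ((fun x : EuclideanSpace ℝ (Fin N) => ‖x‖) ⁻¹' s) := measurable_norm hs
  have ht' : MeasurableSet (radialProj N ⁻¹' t) := measurable_radialProj N ht
  calc γ ((fun x => ‖x‖) ⁻¹' s ∩ radialProj N ⁻¹' t)
      = ∫⁻ x, t.indicator 1 (radialProj N x) * s.indicator 1 ‖x‖ ∂γ := by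
        rw [← lintegral_indicator_one (hs'.inter ht'), Set.inter_comm, Set.inter_indicator_one]
        rfl
    _ = uniformMeasure N t * ∫⁻ x, s.indicator 1 ‖x‖ ∂γ := by
        rw [lintegral_radialProj_mul_norm_stdGaussian (measurable_one.indicator ht)
          (measurable_one.indicator hs), lintegral_indicator_one ht]
    _ = γ ((fun x => ‖x‖) ⁻¹' s) * γ (radialProj N ⁻¹' t) := by
        rw [← map_radialProj_stdGaussian, Measure.map_apply (by fun_prop) ht,
          ← lintegral_indicator_one hs', mul_comm]
        rfl

theorem isProbabilityMeasure_uniformMeasure (N : ℕ) [NeZero N] :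
    IsProbabilityMeasure (uniformMeasure N) := by
  rw [← map_radialProj_stdGaussian]
  exact Measure.isProbabilityMeasure_map (by fun_prop)

end RadialProjection

section IndependentVariables

/-- The vector of the first `N` terms of a real sequence. -/
def initialVector (N : ℕ) (ω : ℕ → ℝ) : EuclideanSpace ℝ (Fin N) :=
  WithLp.toLp 2 fun i => ω i

/-- The law on `ℝ^N` of a vector with `N` independent coordinates of law `μ`. -/
noncomputable def iidLaw (μ : Measure ℝ) (N : ℕ) : Measure (EuclideanSpace ℝ (Fin N)) :=
  (Measure.pi fun _ : Fin N => μ).map (WithLp.toLp 2)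

@[fun_prop]
theorem measurable_initialVector (N : ℕ) : Measurable (initialVector N) := by
  unfold initialVector
  fun_prop

theorem iidLaw_gaussianReal (N : ℕ) :
    iidLaw (gaussianReal 0 1) N = stdGaussian (EuclideanSpace ℝ (Fin N)) :=
  map_pi_eq_stdGaussian

variable (μ : Measure ℝ) [IsProbabilityMeasure μ]

instance (N : ℕ) : IsProbabilityMeasure (iidLaw μ N) :=
  Measure.isProbabilityMeasure_map (by fun_prop)

theorem map_initialVector_infinitePi (N : ℕ) :
    (Measure.infinitePi fun _ : ℕ => μ).map (initialVector N) = iidLaw μ N := by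
  rw [iidLaw, ← Measure.infinitePi_eq_pi,
    ← Measure.map_infinitePi_infinitePi_of_inj (P := fun _ : ℕ => μ) Fin.val_injective,
    Measure.map_map (by fun_prop) (by fun_prop)]
  rfl

theorem map_piLpCongrLeft_iidLaw {N : ℕ} (π : Equiv.Perm (Fin N)) :
    (iidLaw μ N).map (LinearIsometryEquiv.piLpCongrLeft 2 ℝ ℝ π) = iidLaw μ N := by
  have hpi : (Measure.pi fun _ : Fin N => μ).map (fun x i => x (π.symm i)) =
      Measure.pi fun _ : Fin N => μ := by
    rw [← Measure.infinitePi_eq_pi,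
      Measure.map_infinitePi_infinitePi_of_inj (P := fun _ : Fin N => μ) π.symm.injective]
  conv_rhs => rw [iidLaw, ← hpi]
  rw [iidLaw, Measure.map_map (LinearIsometryEquiv.continuous _).measurable (by fun_prop),
    Measure.map_map (by fun_prop) (by fun_prop)]
  rfl

theorem klDiv_iidLaw (ν : Measure ℝ) [IsProbabilityMeasure ν] (N : ℕ) :
    klDiv (iidLaw μ N) (iidLaw ν N) = N * klDiv μ ν := by
  refine (klDiv_map_measurableEquiv _ _ (MeasurableEquiv.toLp 2 (Fin N → ℝ))).trans ?_
  rw [klDiv_pi, Finset.sum_const, Finset.card_univ, Fintype.card_fin, nsmul_eq_mul]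

theorem integral_prod_iidLaw (g : ℝ → ℝ) (N : ℕ) :
    ∫ x, ∏ i, g (x i) ∂(iidLaw μ N) = (∫ v, g v ∂μ) ^ N := by
  refine ((MeasurableEquiv.toLp 2 (Fin N → ℝ)).measurableEmbedding.integral_map _).trans ?_
  refine (integral_fintype_prod_eq_pow g).trans ?_
  rw [Fintype.card_fin]

theorem ae_tendsto_average_infinitePi {g : ℝ → ℝ} (hg : Measurable g) (hint : Integrable g μ) :
    ∀ᵐ ω ∂(Measure.infinitePi fun _ : ℕ => μ),
      Tendsto (fun n : ℕ => (∑ i ∈ Finset.range n, g (ω i)) / n) atTop (𝓝 (∫ v, g v ∂μ)) := by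
  have heval : ∀ i, MeasurePreserving (fun ω : ℕ → ℝ => ω i)
      (Measure.infinitePi fun _ : ℕ => μ) μ := measurePreserving_eval_infinitePi fun _ : ℕ => μ
  have hindep : Pairwise fun i j : ℕ => IndepFun (fun ω : ℕ → ℝ => g (ω i)) (fun ω => g (ω j))
      (Measure.infinitePi fun _ : ℕ => μ) := fun i j hij =>
    (iIndepFun_infinitePi (P := fun _ : ℕ => μ) (X := fun _ => g) fun _ => hg).indepFun hij
  have hident : ∀ i, IdentDistrib (fun ω : ℕ → ℝ => g (ω i)) (fun ω => g (ω 0))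
      (Measure.infinitePi fun _ : ℕ => μ) (Measure.infinitePi fun _ : ℕ => μ) := fun i =>
    IdentDistrib.comp ⟨(heval i).aemeasurable, (heval 0).aemeasurable,
      (heval i).map_eq.trans (heval 0).map_eq.symm⟩ hg
  have hmean : ∫ ω : ℕ → ℝ, g (ω 0) ∂(Measure.infinitePi fun _ : ℕ => μ) = ∫ v, g v ∂μ := by
    conv_rhs => rw [← (heval 0).map_eq]
    rw [integral_map (heval 0).aemeasurable hg.aestronglyMeasurable]
  rw [← hmean]
  exact strong_law_ae_real (fun i (ω : ℕ → ℝ) => g (ω i))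
    ((heval 0).integrable_comp_of_integrable hint) hindep hident

variable {μ}

theorem ae_tendsto_sqrt_div_norm_initialVector (hμ : ∫ v, v ^ 2 ∂μ = 1) :
    ∀ᵐ ω ∂(Measure.infinitePi fun _ : ℕ => μ),
      Tendsto (fun N : ℕ => √N / ‖initialVector N ω‖) atTop (𝓝 1) := by
  filter_upwards [ae_tendsto_average_infinitePi μ (g := fun v => v ^ 2) (by fun_prop)
    (Integrable.of_integral_ne_zero (by simp [hμ]))] with ω hω
  rw [hμ] at hω
  have hsqrt : Tendsto (fun N : ℕ => √((∑ i ∈ Finset.range N, ω i ^ 2) / N)⁻¹) atTop (𝓝 1) := by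
    simpa using (hω.inv₀ one_ne_zero).sqrt
  refine hsqrt.congr fun N => ?_
  rw [inv_div, Real.sqrt_div N.cast_nonneg, EuclideanSpace.norm_eq, Finset.sum_range]
  simp [initialVector]

theorem tendsto_iidLaw_sqrt_div_norm_mem (hμ : ∫ v, v ^ 2 ∂μ = 1) {s : Set ℝ}
    (hs : MeasurableSet s) (hs_nhds : s ∈ 𝓝 1) :
    Tendsto (fun N : ℕ => iidLaw μ N {x | √N / ‖x‖ ∈ s}) atTop (𝓝 1) := by
  have hmeas : ∀ N : ℕ, Measurable fun x : EuclideanSpace ℝ (Fin N) => √N / ‖x‖ := by fun_prop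
  have hpre : ∀ N : ℕ, iidLaw μ N {x | √N / ‖x‖ ∈ s} =
      (Measure.infinitePi fun _ : ℕ => μ) {ω | √N / ‖initialVector N ω‖ ∈ s} := fun N => by
    rw [← map_initialVector_infinitePi]
    exact Measure.map_apply (measurable_initialVector N) (hmeas N hs)
  rw [← measure_univ (μ := Measure.infinitePi fun _ : ℕ => μ)]
  simp_rw [hpre]
  refine tendsto_measure_of_ae_tendsto_indicator_of_isFiniteMeasure _ MeasurableSet.univ
    (fun N => ((hmeas N).comp (measurable_initialVector N)) hs) ?_
  filter_upwards [ae_tendsto_sqrt_div_norm_initialVector hμ] with ω hω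
  filter_upwards [hω.eventually_mem hs_nhds] with N hN
  simpa using hN

end IndependentVariables

section ProjectedLaw

variable (μ : Measure ℝ)

/-- The law on `S^{N-1}(√N)` of the radial projection of a vector with `N` independent coordinates
of law `μ`. -/
noncomputable def projectedLaw (N : ℕ) : Measure (KacSphere N) :=
  (iidLaw μ N).map (radialProj N)

variable [IsProbabilityMeasure μ]

instance (N : ℕ) : IsProbabilityMeasure (projectedLaw μ N) :=
  Measure.isProbabilityMeasure_map (by fun_prop)

theorem map_permute_projectedLaw {N : ℕ} (π : Equiv.Perm (Fin N)) :
    (projectedLaw μ N).map (permute π) = projectedLaw μ N := by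
  have hcomm : permute π ∘ radialProj N =
      radialProj N ∘ LinearIsometryEquiv.piLpCongrLeft 2 ℝ ℝ π := funext (permute_radialProj π)
  rw [projectedLaw, Measure.map_map (measurable_permute π) (by fun_prop), hcomm,
    ← Measure.map_map (by fun_prop) (LinearIsometryEquiv.continuous _).measurable,
    map_piLpCongrLeft_iidLaw]

theorem tendsto_firstCoords_radialProj_initialVector {ω : ℕ → ℝ}
    (hω : Tendsto (fun N : ℕ => √N / ‖initialVector N ω‖) atTop (𝓝 1)) (k : ℕ) :
    Tendsto (fun N => firstCoords k N (radialProj N (initialVector N ω))) atTop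
      (𝓝 fun i => ω i) := by
  refine tendsto_pi_nhds.2 fun i => ?_
  have hmul : Tendsto (fun N : ℕ => √N / ‖initialVector N ω‖ * ω i) atTop (𝓝 (ω i)) := by
    simpa using hω.mul_const (ω i)
  refine hmul.congr' ?_
  filter_upwards [hω.eventually_ne one_ne_zero, eventually_ge_atTop k] with N hN hk
  have hne : initialVector N ω ≠ 0 := fun h => hN (by rw [h, norm_zero, div_zero])
  rw [firstCoords, dif_pos (i.2.trans_le hk), coe_radialProj_of_ne_zero hne]
  rfl

theorem tendsto_integral_marginal_projectedLaw (hμ : ∫ v, v ^ 2 ∂μ = 1) (k : ℕ)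
    (χ : (Fin k → ℝ) →ᵇ ℝ) :
    Tendsto (fun N : ℕ => ∫ v, χ v ∂(marginal k (projectedLaw μ N))) atTop
      (𝓝 (∫ v, χ v ∂(Measure.pi fun _ : Fin k => μ))) := by
  have hsphere : ∀ N, ∫ v, χ v ∂(marginal k (projectedLaw μ N)) =
      ∫ ω, χ (firstCoords k N (radialProj N (initialVector N ω)))
        ∂(Measure.infinitePi fun _ : ℕ => μ) := fun N => by
    rw [marginal, projectedLaw, ← map_initialVector_infinitePi,
      Measure.map_map (by fun_prop) (by fun_prop), Measure.map_map (by fun_prop) (by fun_prop),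
      integral_map (by fun_prop) χ.continuous.aestronglyMeasurable]
    rfl
  have hlimit : ∫ v, χ v ∂(Measure.pi fun _ : Fin k => μ) =
      ∫ ω, χ (fun i : Fin k => ω i) ∂(Measure.infinitePi fun _ : ℕ => μ) := by
    rw [← Measure.infinitePi_eq_pi,
      ← Measure.map_infinitePi_infinitePi_of_inj (P := fun _ : ℕ => μ) Fin.val_injective,
      integral_map (Measurable.aemeasurable (by fun_prop)) χ.continuous.aestronglyMeasurable]
  simp_rw [hsphere, hlimit]
  refine tendsto_integral_of_dominated_convergence (fun _ => ‖χ‖)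
    (fun N => (χ.continuous.measurable.comp (by fun_prop)).aestronglyMeasurable)
    (integrable_const _) (fun N => ae_of_all _ fun ω => χ.norm_coe_le_norm _) ?_
  filter_upwards [ae_tendsto_sqrt_div_norm_initialVector hμ] with ω hω
  exact (χ.continuous.tendsto _).comp (tendsto_firstCoords_radialProj_initialVector hω k)

end ProjectedLaw

section ExponentialMoments

/-- The sum `∑ᵢ φ(vᵢ)` over the coordinates of a point of `S^{N-1}(√N)`, the test function on the
sphere built from a test function `φ` on `ℝ`. -/
def coordSum (φ : ℝ → ℝ) (N : ℕ) (v : KacSphere N) : ℝ :=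
  ∑ i, φ ((v : EuclideanSpace ℝ (Fin N)) i)

variable {φ : ℝ → ℝ}

theorem measurable_coordSum (hφ : Measurable φ) (N : ℕ) : Measurable (coordSum φ N) := by
  unfold coordSum
  fun_prop

theorem abs_coordSum_le {M : ℝ} (hM : ∀ v, |φ v| ≤ M) {N : ℕ} (v : KacSphere N) :
    |coordSum φ N v| ≤ N * M := by
  refine (Finset.abs_sum_le_sum_abs _ _).trans ((Finset.sum_le_sum fun i _ => hM _).trans ?_)
  simp

theorem exp_coordSum_radialProj_le {N : ℕ} {ε : ℝ} {x : EuclideanSpace ℝ (Fin N)} (hx : x ≠ 0)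
    (hφ : ∀ v, φ (√N / ‖x‖ * v) ≤ ε + φ v) :
    Real.exp (coordSum φ N (radialProj N x)) ≤ ∏ i, Real.exp (ε + φ (x i)) := by
  rw [← Real.exp_sum, Real.exp_le_exp, coordSum, coe_radialProj_of_ne_zero hx]
  exact Finset.sum_le_sum fun i _ => hφ (x i)

theorem integrable_prod_exp {N : ℕ} (κ : Measure (EuclideanSpace ℝ (Fin N))) [IsFiniteMeasure κ]
    (hφ : Measurable φ) {M : ℝ} (hM : ∀ v, |φ v| ≤ M) :
    Integrable (fun x => ∏ i, Real.exp (φ (x i))) κ := by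
  simp only [← Real.exp_sum]
  refine integrable_exp_of_abs_le (M := N * M) (by fun_prop) fun x => ?_
  refine (Finset.abs_sum_le_sum_abs _ _).trans ((Finset.sum_le_sum fun i _ => hM (x i)).trans ?_)
  simp

theorem measureReal_mul_integral_exp_coordSum_le (hφ : Measurable φ) {M : ℝ} (hM : ∀ v, |φ v| ≤ M)
    {ε : ℝ} {s : Set ℝ} (hs : MeasurableSet s) (hs₀ : 0 ∉ s)
    (hφs : ∀ t ∈ s, ∀ v, φ (t * v) ≤ ε + φ v) (N : ℕ) [NeZero N] :
    (stdGaussian (EuclideanSpace ℝ (Fin N))).real {x | √N / ‖x‖ ∈ s} *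
        ∫ v, Real.exp (coordSum φ N v) ∂(uniformMeasure N)
      ≤ (Real.exp ε * ∫ v, Real.exp (φ v) ∂(gaussianReal 0 1)) ^ N := by
  set γ := stdGaussian (EuclideanSpace ℝ (Fin N)) with hγ
  set A : Set (EuclideanSpace ℝ (Fin N)) := {x | √N / ‖x‖ ∈ s}
  have hquot : Measurable fun r : ℝ => √N / r := by fun_prop
  have hA : MeasurableSet A := (hquot.comp measurable_norm) hs
  have hexp : Measurable fun v => Real.exp (coordSum φ N v) := (measurable_coordSum hφ N).exp
  have hint_sphere : Integrable (fun x => Real.exp (coordSum φ N (radialProj N x))) γ :=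
    integrable_exp_of_abs_le ((measurable_coordSum hφ N).comp (by fun_prop)).aemeasurable
      fun x => abs_coordSum_le hM _
  have hint_prod : Integrable (fun x => ∏ i, Real.exp (ε + φ (x i))) γ :=
    integrable_prod_exp γ (hφ.const_add ε)
      fun v => (abs_add_le _ _).trans (add_le_add_right (hM v) |ε|)
  calc γ.real A * ∫ v, Real.exp (coordSum φ N v) ∂(uniformMeasure N)
      = γ.real A * ∫ x, Real.exp (coordSum φ N (radialProj N x)) ∂γ := by
        rw [← map_radialProj_stdGaussian, integral_map (by fun_prop) hexp.aestronglyMeasurable]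
    _ = ∫ x in A, Real.exp (coordSum φ N (radialProj N x)) ∂γ :=
        (Indep.setIntegral_eq_mul measurable_norm.comap_le (indepFun_norm_radialProj_stdGaussian N)
          (by fun_prop) ⟨_, hquot hs, rfl⟩ hexp.aestronglyMeasurable).symm
    _ ≤ ∫ x in A, ∏ i, Real.exp (ε + φ (x i)) ∂γ := by
        refine setIntegral_mono_on hint_sphere.integrableOn hint_prod.integrableOn hA fun x hx => ?_
        refine exp_coordSum_radialProj_le ?_ (hφs _ hx)
        rintro rfl
        simp [A, hs₀] at hx
    _ ≤ ∫ x, ∏ i, Real.exp (ε + φ (x i)) ∂γ :=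
        setIntegral_le_integral hint_prod (ae_of_all _ fun x => by positivity)
    _ = (Real.exp ε * ∫ v, Real.exp (φ v) ∂(gaussianReal 0 1)) ^ N := by
        rw [hγ, ← iidLaw_gaussianReal, integral_prod_iidLaw _ fun v => Real.exp (ε + φ v)]
        simp only [Real.exp_add, integral_const_mul]

theorem integral_sq_gaussianReal : ∫ v, v ^ 2 ∂(gaussianReal 0 1) = 1 := by
  have hvar := variance_id_gaussianReal (μ := 0) (v := 1)
  rw [variance_eq_integral (by fun_prop)] at hvar
  simpa [integral_id_gaussianReal] using hvar

theorem eventually_integral_exp_coordSum_le (hφ : Continuous φ) (hφ_supp : HasCompactSupport φ)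
    {ε : ℝ} (hε : 0 < ε) :
    ∀ᶠ N : ℕ in atTop, ∫ v, Real.exp (coordSum φ N v) ∂(uniformMeasure N)
      ≤ 2 * (Real.exp ε * ∫ v, Real.exp (φ v) ∂(gaussianReal 0 1)) ^ N := by
  obtain ⟨M, hM⟩ := hφ_supp.exists_bound_of_continuous hφ
  obtain ⟨s, hs, hs_open, hs_one⟩ := eventually_nhds_iff.1 <|
    (eventually_forall_abs_comp_smul_sub_lt hφ hφ_supp hε).and (eventually_ne_nhds one_ne_zero)
  have hprob := tendsto_iidLaw_sqrt_div_norm_mem integral_sq_gaussianReal hs_open.measurableSet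
    (hs_open.mem_nhds hs_one)
  filter_upwards [hprob.eventually_const_lt ENNReal.one_half_lt_one, eventually_ne_atTop 0]
    with N hN hN₀
  have : NeZero N := ⟨hN₀⟩
  have hmoment := measureReal_mul_integral_exp_coordSum_le hφ.measurable hM hs_open.measurableSet
    (fun h => (hs 0 h).2 rfl)
    (fun t ht v => (sub_lt_iff_lt_add.1 (abs_lt.1 ((hs t ht).1 v)).2).le) N
  rw [iidLaw_gaussianReal] at hN
  have hhalf : 1 / 2 ≤ (stdGaussian (EuclideanSpace ℝ (Fin N))).real {x | √N / ‖x‖ ∈ s} := by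
    simpa [Measure.real] using ENNReal.toReal_mono (by finiteness) hN.le
  have hnonneg : 0 ≤ ∫ v, Real.exp (coordSum φ N v) ∂(uniformMeasure N) :=
    integral_nonneg fun v => (Real.exp_pos _).le
  linarith [mul_le_mul_of_nonneg_right hhalf hnonneg]

end ExponentialMoments

section EntropyLimit

variable {μ : Measure ℝ} [IsProbabilityMeasure μ]

theorem klDiv_projectedLaw_le (μ : Measure ℝ) [IsProbabilityMeasure μ] (N : ℕ) [NeZero N] :
    klDiv (projectedLaw μ N) (uniformMeasure N) ≤ N * klDiv μ (gaussianReal 0 1) := by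
  rw [← map_radialProj_stdGaussian, projectedLaw, ← klDiv_iidLaw, iidLaw_gaussianReal]
  exact klDiv_map_le _ _ (by fun_prop)

theorem integral_coordSum_projectedLaw {φ : ℝ → ℝ} (hφ : Measurable φ) {M : ℝ}
    (hM : ∀ v, |φ v| ≤ M) (N : ℕ) [NeZero N] :
    ∫ v, coordSum φ N v ∂(projectedLaw μ N)
      = N * ∫ x, φ (x 0) ∂(marginal 1 (projectedLaw μ N)) := by
  have hmeas : ∀ i, Measurable fun v : KacSphere N => φ ((v : EuclideanSpace ℝ (Fin N)) i) :=
    fun i => by fun_prop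
  have hexch : ∀ i, ∫ v, φ ((v : EuclideanSpace ℝ (Fin N)) i) ∂(projectedLaw μ N)
      = ∫ v, φ ((v : EuclideanSpace ℝ (Fin N)) 0) ∂(projectedLaw μ N) := fun i => by
    conv_lhs => rw [← map_permute_projectedLaw μ (Equiv.swap 0 i)]
    rw [integral_map (measurable_permute _).aemeasurable (hmeas i).aestronglyMeasurable]
    simp [permute]
  have hmarg : ∫ x, φ (x 0) ∂(marginal 1 (projectedLaw μ N))
      = ∫ v, φ ((v : EuclideanSpace ℝ (Fin N)) 0) ∂(projectedLaw μ N) := by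
    rw [marginal, integral_map (by fun_prop) (Measurable.aestronglyMeasurable (by fun_prop))]
    simp only [firstCoords, Fin.val_zero, Nat.pos_of_neZero, dif_pos]
    rfl
  simp only [coordSum]
  rw [integral_finsetSum _ fun i _ =>
    Integrable.of_bound (hmeas i).aestronglyMeasurable M (ae_of_all _ fun v => hM _)]
  simp [hexch, hmarg]

theorem tendsto_integral_marginal_one_projectedLaw (hμ : ∫ v, v ^ 2 ∂μ = 1) {φ : ℝ → ℝ}
    (hφ : Continuous φ) {M : ℝ} (hM : ∀ v, |φ v| ≤ M) :
    Tendsto (fun N : ℕ => ∫ x, φ (x 0) ∂(marginal 1 (projectedLaw μ N))) atTop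
      (𝓝 (∫ v, φ v ∂μ)) := by
  have heval := (measurePreserving_eval (fun _ : Fin 1 => μ) 0).map_eq
  conv => enter [3]; rw [← heval]
  rw [integral_map (measurable_pi_apply 0).aemeasurable hφ.aestronglyMeasurable]
  exact tendsto_integral_marginal_projectedLaw μ hμ 1
    (BoundedContinuousFunction.ofNormedAddCommGroup (fun x : Fin 1 → ℝ => φ (x 0)) (by fun_prop) M
      fun x => hM _)

theorem eventually_mul_le_dvFunctional_coordSum (hμ : ∫ v, v ^ 2 ∂μ = 1) {φ : ℝ → ℝ}
    (hφ : Continuous φ) (hφ_supp : HasCompactSupport φ) {c : ℝ}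
    (hc : c < dvFunctional μ (gaussianReal 0 1) φ) :
    ∀ᶠ N : ℕ in atTop,
      N * c ≤ dvFunctional (projectedLaw μ N) (uniformMeasure N) (coordSum φ N) := by
  obtain ⟨M, hM⟩ := hφ_supp.exists_bound_of_continuous hφ
  rw [dvFunctional] at hc
  set Z := ∫ v, Real.exp (φ v) ∂(gaussianReal 0 1)
  have hZ : 0 < Z := integral_exp_pos (integrable_exp_of_abs_le (by fun_prop) hM)
  obtain ⟨ε, hε, hcε⟩ : ∃ ε > 0, c + 3 * ε = ∫ v, φ v ∂μ - Real.log Z :=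
    ⟨(∫ v, φ v ∂μ - Real.log Z - c) / 3, by linarith, by ring⟩
  have hmean := (tendsto_integral_marginal_one_projectedLaw hμ hφ hM).eventually_const_lt
    (sub_lt_self _ hε)
  have hlog_two := (tendsto_natCast_atTop_atTop.atTop_mul_const hε).eventually_ge_atTop (Real.log 2)
  filter_upwards [hmean, hlog_two, eventually_integral_exp_coordSum_le hφ hφ_supp hε,
    eventually_ne_atTop 0] with N hN_mean hN_log hN_exp hN₀
  have : NeZero N := ⟨hN₀⟩
  have := isProbabilityMeasure_uniformMeasure N
  have hexp_pos : 0 < ∫ v, Real.exp (coordSum φ N v) ∂(uniformMeasure N) :=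
    integral_exp_pos <| integrable_exp_of_abs_le (measurable_coordSum hφ.measurable N).aemeasurable
      (abs_coordSum_le hM)
  have hlog : Real.log (∫ v, Real.exp (coordSum φ N v) ∂(uniformMeasure N)) ≤
      Real.log 2 + N * (ε + Real.log Z) := by
    refine (Real.log_le_log hexp_pos hN_exp).trans_eq ?_
    rw [Real.log_mul two_ne_zero (by positivity), Real.log_pow,
      Real.log_mul (Real.exp_pos ε).ne' hZ.ne', Real.log_exp]
  rw [dvFunctional, integral_coordSum_projectedLaw hφ.measurable hM]
  calc N * c = N * (∫ v, φ v ∂μ - ε) - (N * ε + N * (ε + Real.log Z)) := by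
        linear_combination (N : ℝ) * hcε
    _ ≤ _ := sub_le_sub (by gcongr) (hlog.trans (by gcongr))

theorem eventually_ofReal_le_klDiv_projectedLaw_div (hμ : ∫ v, v ^ 2 ∂μ = 1) {φ : ℝ → ℝ}
    (hφ : Continuous φ) (hφ_supp : HasCompactSupport φ) {c : ℝ}
    (hc : c < dvFunctional μ (gaussianReal 0 1) φ) :
    ∀ᶠ N : ℕ in atTop,
      ENNReal.ofReal c ≤ klDiv (projectedLaw μ N) (uniformMeasure N) / (N : ℝ≥0∞) := by
  obtain ⟨M, hM⟩ := hφ_supp.exists_bound_of_continuous hφ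
  filter_upwards [eventually_mul_le_dvFunctional_coordSum hμ hφ hφ_supp hc, eventually_ne_atTop 0]
    with N hN hN₀
  have : NeZero N := ⟨hN₀⟩
  have := isProbabilityMeasure_uniformMeasure N
  have hmeas := measurable_coordSum hφ.measurable N
  rw [ENNReal.le_div_iff_mul_le (by simp [hN₀]) (by simp), mul_comm, ← ENNReal.ofReal_natCast,
    ← ENNReal.ofReal_mul N.cast_nonneg]
  refine (ENNReal.ofReal_le_ofReal hN).trans (ofReal_dvFunctional_le_klDiv _ _ ?_ ?_)
  · exact Integrable.of_bound hmeas.aestronglyMeasurable (N * M) (ae_of_all _ (abs_coordSum_le hM))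
  · exact integrable_exp_of_abs_le hmeas.aemeasurable (abs_coordSum_le hM)

theorem tendsto_klDiv_projectedLaw_div (hμ : ∫ v, v ^ 2 ∂μ = 1) :
    Tendsto (fun N : ℕ => klDiv (projectedLaw μ N) (uniformMeasure N) / (N : ℝ≥0∞)) atTop
      (𝓝 (klDiv μ (gaussianReal 0 1))) := by
  refine tendsto_order.2 ⟨fun c hc => ?_, fun c hc => ?_⟩
  · obtain ⟨φ, hφ, hφ_supp, hcφ⟩ := exists_hasCompactSupport_lt_dvFunctional hc
    obtain ⟨b, hcb, hbφ⟩ := exists_between hcφ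
    filter_upwards [eventually_ofReal_le_klDiv_projectedLaw_div hμ hφ hφ_supp
      ((ENNReal.lt_ofReal_iff_toReal_lt hbφ.ne_top).1 hbφ)] with N hN
    rw [ENNReal.ofReal_toReal hbφ.ne_top] at hN
    exact hcb.trans_le hN
  · filter_upwards [eventually_ne_atTop 0] with N hN₀
    have : NeZero N := ⟨hN₀⟩
    refine (ENNReal.div_le_of_le_mul ?_).trans_lt hc
    rw [mul_comm]
    exact klDiv_projectedLaw_le μ N

end EntropyLimit

section DensityMeasure

variable {f : ℝ → ℝ}

theorem isProbabilityMeasure_densityMeasure (hf_nonneg : ∀ v, 0 ≤ f v) (hf_mass : ∫ v, f v = 1) :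
    IsProbabilityMeasure (densityMeasure f) := by
  have hf : Integrable f := Integrable.of_integral_ne_zero (by simp [hf_mass])
  refine ⟨?_⟩
  rw [densityMeasure, withDensity_apply _ MeasurableSet.univ, Measure.restrict_univ,
    ← ofReal_integral_eq_lintegral_ofReal hf (ae_of_all _ hf_nonneg), hf_mass, ENNReal.ofReal_one]

theorem integral_densityMeasure (hf : AEMeasurable f) (hf_nonneg : ∀ v, 0 ≤ f v) (g : ℝ → ℝ) :
    ∫ v, g v ∂(densityMeasure f) = ∫ v, f v * g v := by
  rw [densityMeasure, integral_withDensity_eq_integral_toReal_smul₀ hf.ennreal_ofReal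
    (ae_of_all _ fun v => ENNReal.ofReal_lt_top)]
  simp only [ENNReal.toReal_ofReal (hf_nonneg _), smul_eq_mul]

end DensityMeasure

end KacChaos

theorem mainTheorem3_general (μ : Measure ℝ) [IsProbabilityMeasure μ] (hμ : ∫ v, v ^ 2 ∂μ = 1) :
    ∃ μN : (N : ℕ) → Measure (KacChaos.KacSphere N), KacChaos.IsEntropicallyChaotic μ μN :=
  ⟨KacChaos.projectedLaw μ,
    { isProbabilityMeasure := fun _ _ => inferInstance
      symmetric := fun _ _ π => KacChaos.map_permute_projectedLaw μ π
      tendsto_marginal := fun k _ χ => KacChaos.tendsto_integral_marginal_projectedLaw μ hμ k χ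
      tendsto_entropy := KacChaos.tendsto_klDiv_projectedLaw_div hμ }⟩

theorem mainTheorem3 (f : ℝ → ℝ)
    (hf_nonneg : ∀ v, 0 ≤ f v)
    (hf_integrable : Integrable f)
    (hf_mass : ∫ v, f v = 1)
    (hf_moment_integrable : Integrable (fun v => f v * v ^ 2))
    (hf_moment : ∫ v, f v * v ^ 2 = 1)
    (hf_entropy : InformationTheory.klDiv (KacChaos.densityMeasure f)
      (ProbabilityTheory.gaussianReal 0 1) < ⊤) :
    ∃ μN : (N : ℕ) → Measure (KacChaos.KacSphere N),
      KacChaos.IsEntropicallyChaotic (KacChaos.densityMeasure f) μN := by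
  have := KacChaos.isProbabilityMeasure_densityMeasure hf_nonneg hf_mass
  exact mainTheorem3_general _
    ((KacChaos.integral_densityMeasure hf_integrable.aemeasurable hf_nonneg _).trans hf_moment)
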